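/- Let $D\in\mathbb N$ and let $\tilde\rho_*:\mathbb R^D\times[0,1]\to(0,\infty)$ be continuously differentiable, with every $\tilde\rho_*(\cdot,t)$ Lebesgue integrable. Put $\mathcal Z(t)=\int\tilde\rho_*(x,t)\,dx$, $\rho_*(x,t)=\tilde\rho_*(x,t)/\mathcal Z(t)$, $S_*=\nabla_x\log\rho_*$, and let $\rho_*(t)$ also denote the probability measure with density $\rho_*(\cdot,t)$; assume that $\tilde\rho_*(\cdot,0)$ is the density of a probability measure $\mu$ (so $\mathcal Z(0)=1$). Let $v_\theta:\mathbb R^D\times[0,1]\to\mathbb R^D$ be a velocity field that is continuous and differentiable in $x$, with derivative $D_xv_\theta$ continuous in $(x,t)$, and suppose that for every $x_0\in\mathbb R^D$ the equation $\dot x(t)=v_\theta(x(t),t)$, $x(0)=x_0$, has a solution $x(t;x_0)$ on all of $[0,1]$. Let $\rho_\theta(t)$ be the law of $x(t;x_0)$ when $x_0\sim\mu$. Define $$\varepsilon(x,t)=\nabla_x\cdot v_\theta(x,t)+S_*(x,t)\cdot v_\theta(x,t)+\partial_t\log\tilde\rho_*(x,t)-\mathbb E_{x'\sim\rho_*(t)}\big[\partial_t\log\tilde\rho_*(x',t)\big],\qquad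 \tilde w(t;x_0)=\exp\Big(\int_0^t\varepsilon(x(s;x_0),s)\,ds\Big).$$ Let $x_0^{(1)},x_0^{(2)},\dots$ be i.i.d. with law $\mu$, let $x^{(i)}(s)=x(s;x_0^{(i)})$, and for $N\ge1$ set $$w_i(s)=\frac{\tilde w(s;x_0^{(i)})}{\sum_{j=1}^N\tilde w(s;x_0^{(j)})},\qquad W_N(s)=\sum_{i=1}^N w_i(s)\,\partial_s\log\tilde\rho_*\big(x^{(i)}(s),s\big).$$ Fix $t\in[0,1]$. Suppose that for every $s\in[0,t]$ the function $\partial_s\log\tilde\rho_*(\cdot,s)$ is integrable with respect to $\rho_*(s)$ and $\rho_\theta(s)$ dominates $\rho_*(s)$ (that is, $\rho_*(s)\ll\rho_\theta(s)$), and that there are constants $M_1,M_2$ with $|\tilde w(s;x_0)|<M_1$ and $|\partial_s\log\tilde\rho_*(x,s)|<M_2$ for all $s\in[0,t]$ and $x_0,x\in\mathbb R^D$. Then $W_N$ is integrable on $[0,t]$ and $$\int_0^tW_N(s)\,ds\ \longrightarrow\ \log\mathcal Z(t)\quad\text{almost surely as }N\to\infty .$$ Moreover the estimator is asymptotically unbiased: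 $\int_0^tW_N(s)\,ds$ is an integrable random variable and $\mathbb E\big[\int_0^tW_N(s)\,ds\big]\to\log\mathcal Z(t)$ as $N\to\infty$. -/

import Mathlib

open MeasureTheory ProbabilityTheory Set Filter
open scoped Topology

noncomputable section

namespace LFIS

variable {D : ℕ}

/-- The normalization constant `Z(t) = ∫ ρ̃(x,t) dx` of the unnormalized density `ρ̃(·,t)`.
Time is the first argument of `ρ`, space the second. -/
def partitionFn (ρ : ℝ → EuclideanSpace ℝ (Fin D) → ℝ) (t : ℝ) : ℝ :=
  ∫ x, ρ t x

/-- The normalized target density `ρ_*(x,t) = ρ̃(x,t) / Z(t)`. -/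
def targetDensity (ρ : ℝ → EuclideanSpace ℝ (Fin D) → ℝ) (t : ℝ)
    (x : EuclideanSpace ℝ (Fin D)) : ℝ :=
  ρ t x / partitionFn ρ t

/-- The target distribution `ρ_*(t)` on `ℝ^D`. -/
def targetMeasure (ρ : ℝ → EuclideanSpace ℝ (Fin D) → ℝ) (t : ℝ) :
    Measure (EuclideanSpace ℝ (Fin D)) :=
  volume.withDensity (fun x => ENNReal.ofReal (targetDensity ρ t x))

/-- `∂_t log ρ̃(x,t)` for `t ∈ [0,1]` (one-sided at the two end points). -/
def dtLog (ρ : ℝ → EuclideanSpace ℝ (Fin D) → ℝ) (t : ℝ)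
    (x : EuclideanSpace ℝ (Fin D)) : ℝ :=
  derivWithin (fun s => Real.log (ρ s x)) (Icc 0 1) t

/-- The score `S_*(x,t) = ∇_x log ρ_*(x,t)`. -/
def score (ρ : ℝ → EuclideanSpace ℝ (Fin D) → ℝ) (t : ℝ)
    (x : EuclideanSpace ℝ (Fin D)) : EuclideanSpace ℝ (Fin D) :=
  gradient (fun y => Real.log (targetDensity ρ t y)) x

/-- The source term `∂_t δ log ρ̃(x,t) = ∂_t log ρ̃(x,t) - ⟨∂_t log ρ̃(·,t)⟩_*`, where `⟨·⟩_*` is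
the mean under the target distribution at time `t`; it equals `∂_t log ρ_*(x,t)`. -/
def sourceTerm (ρ : ℝ → EuclideanSpace ℝ (Fin D) → ℝ) (t : ℝ)
    (x : EuclideanSpace ℝ (Fin D)) : ℝ :=
  dtLog ρ t x - ∫ y, dtLog ρ t y ∂(targetMeasure ρ t)

/-- The divergence `∇ · u` of a vector field, i.e. the trace of its Jacobian. -/
def divergence (u : EuclideanSpace ℝ (Fin D) → EuclideanSpace ℝ (Fin D))
    (x : EuclideanSpace ℝ (Fin D)) : ℝ :=
  LinearMap.trace ℝ (EuclideanSpace ℝ (Fin D)) (fderiv ℝ u x).toLinearMap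

/-- The error function `ε(x,t) = [∇ + S_*(x,t)] · v(x,t) + ∂_t δ log ρ̃(x,t)`. -/
def flowError (v : ℝ → EuclideanSpace ℝ (Fin D) → EuclideanSpace ℝ (Fin D))
    (ρ : ℝ → EuclideanSpace ℝ (Fin D) → ℝ) (t : ℝ) (x : EuclideanSpace ℝ (Fin D)) : ℝ :=
  divergence (v t) x + inner ℝ (score ρ t x) (v t x) + sourceTerm ρ t x

/-- `v` is a velocity field on `ℝ^D × [0,1]` which is continuous, differentiable in space, and
whose spatial derivative is (jointly) continuous. -/
structure IsVelocityField
    (v : ℝ → EuclideanSpace ℝ (Fin D) → EuclideanSpace ℝ (Fin D)) : Prop where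
  continuousOn : ContinuousOn (fun p : ℝ × EuclideanSpace ℝ (Fin D) => v p.1 p.2)
    (Icc 0 1 ×ˢ univ)
  differentiable : ∀ t ∈ Icc (0 : ℝ) 1, Differentiable ℝ (v t)
  continuousOn_fderiv :
    ContinuousOn (fun p : ℝ × EuclideanSpace ℝ (Fin D) => fderiv ℝ (v p.1) p.2)
      (Icc 0 1 ×ˢ univ)

/-- `x t x₀` is the position at time `t ∈ [0,1]` of the trajectory of `ẋ = v(x,t)` that starts
at `x₀`. -/
structure IsFlow (v : ℝ → EuclideanSpace ℝ (Fin D) → EuclideanSpace ℝ (Fin D))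
    (x : ℝ → EuclideanSpace ℝ (Fin D) → EuclideanSpace ℝ (Fin D)) : Prop where
  init : ∀ x₀, x 0 x₀ = x₀
  ode : ∀ x₀, ∀ t ∈ Icc (0 : ℝ) 1,
    HasDerivWithinAt (fun s => x s x₀) (v t (x t x₀)) (Icc 0 1) t

/-- `ρ` is a path of unnormalized probability densities on `ℝ^D`, `t ∈ [0,1]`: positive,
integrable, and continuously differentiable in `(t,x)`, so that the derivatives of its logarithm
exist. -/
structure IsDensityPath (ρ : ℝ → EuclideanSpace ℝ (Fin D) → ℝ) : Prop where
  pos : ∀ t ∈ Icc (0 : ℝ) 1, ∀ x, 0 < ρ t x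
  integrable : ∀ t ∈ Icc (0 : ℝ) 1, Integrable (ρ t)
  contDiffOn : ContDiffOn ℝ 1 (fun p : ℝ × EuclideanSpace ℝ (Fin D) => ρ p.1 p.2)
    (Icc 0 1 ×ˢ univ)

/-- The distribution `ρ_θ(t)` induced by the flow: the law of `x(t;x₀)` when `x₀ ∼ μ`. -/
def flowMeasure (x : ℝ → EuclideanSpace ℝ (Fin D) → EuclideanSpace ℝ (Fin D))
    (μ : Measure (EuclideanSpace ℝ (Fin D))) (t : ℝ) : Measure (EuclideanSpace ℝ (Fin D)) :=
  μ.map (x t)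

/-- The unnormalized weight `w̃(t;x₀) = exp (∫₀ᵗ ε(x(s;x₀),s) ds)`. -/
def unnormWeight (v : ℝ → EuclideanSpace ℝ (Fin D) → EuclideanSpace ℝ (Fin D))
    (ρ : ℝ → EuclideanSpace ℝ (Fin D) → ℝ)
    (x : ℝ → EuclideanSpace ℝ (Fin D) → EuclideanSpace ℝ (Fin D))
    (t : ℝ) (x₀ : EuclideanSpace ℝ (Fin D)) : ℝ :=
  Real.exp (∫ s in (0 : ℝ)..t, flowError v ρ s (x s x₀))

/-- The normalized weight `w_i(t)` of the `i`-th of the `N` samples with starting points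
`z 0, …, z (N - 1)`. -/
def normWeight (v : ℝ → EuclideanSpace ℝ (Fin D) → EuclideanSpace ℝ (Fin D))
    (ρ : ℝ → EuclideanSpace ℝ (Fin D) → ℝ)
    (x : ℝ → EuclideanSpace ℝ (Fin D) → EuclideanSpace ℝ (Fin D))
    (z : ℕ → EuclideanSpace ℝ (Fin D)) (N i : ℕ) (t : ℝ) : ℝ :=
  unnormWeight v ρ x t (z i) / ∑ j ∈ Finset.range N, unnormWeight v ρ x t (z j)

/-- The weighted average `W_N(s) = ∑ᵢ w_i(s) ∂_s log ρ̃(x⁽ⁱ⁾(s),s)` for the starting points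
`z 0, …, z (N - 1)`. -/
def weightedAverage (v : ℝ → EuclideanSpace ℝ (Fin D) → EuclideanSpace ℝ (Fin D))
    (ρ : ℝ → EuclideanSpace ℝ (Fin D) → ℝ)
    (x : ℝ → EuclideanSpace ℝ (Fin D) → EuclideanSpace ℝ (Fin D))
    (z : ℕ → EuclideanSpace ℝ (Fin D)) (N : ℕ) (s : ℝ) : ℝ :=
  ∑ i ∈ Finset.range N, normWeight v ρ x z N i s * dtLog ρ s (x s (z i))

end LFIS

end

/-! Along a trajectory `x s x₀`, with `Φ` the spatial derivative of the flow, Liouville's formula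
gives the logarithmic derivative of `det Φ` as `div v`. The logarithmic derivative of `ρ s (x s x₀)
/ Z s` is `S_* · v + ∂ₛ log ρ̃ - ⟨∂ₛ log ρ̃⟩_*`, because `(log Z)' = ⟨∂ₛ log ρ̃⟩_*`. The two add up
to `ε`, so `ρ₀(x₀) w̃(s;x₀) = |det Φ| ρ_*(x s x₀, s)` (`exists_hasFDerivAt_unnormWeight`).

The flow is injective, so a change of variables turns this identity into `∫ w̃ · (f ∘ x s) dμ = ∫ f
dρ_*(s)`, up to the mass of `ρ_*(s)` outside the range of the flow. That mass vanishes because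
`ρ_θ(s)` dominates `ρ_*(s)` (`integral_unnormWeight_mul`).

For fixed `s`, the law of large numbers applied to numerator and denominator of `W_N(s)` gives the
limit `⟨∂ₛ log ρ̃⟩_*` almost surely (`tendsto_selfNormalized`). Fubini makes the null set
independent of almost every `s`. Since `W_N` is a convex combination, it inherits the bound on `∂ₛ
log ρ̃`, so dominated convergence in `s` gives `∫₀ᵗ ⟨∂ₛ log ρ̃⟩_* ds = log Z(t)`
(`integral_mean_dtLog`). The same bound allows dominated convergence in `ω` for the expectations. -/

namespace LFIS

/-! ### Linear differential equations in a Banach algebra -/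

section LinearODE

variable {𝔸 : Type*} [NormedRing 𝔸] [NormedAlgebra ℝ 𝔸]

/-- The terms of the Peano-Baker series of the linear equation `Φ' = A Φ`. -/
noncomputable def peanoBaker (A : ℝ → 𝔸) : ℕ → ℝ → 𝔸
  | 0 => fun _ => 1
  | n + 1 => fun t => ∫ s in (0 : ℝ)..t, A s * peanoBaker A n s

lemma continuous_peanoBaker {A : ℝ → 𝔸} (hA : Continuous A) (n : ℕ) :
    Continuous (peanoBaker A n) := by
  induction n with
  | zero => exact continuous_const
  | succ n ih =>
    exact intervalIntegral.continuous_primitive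
      (fun a b => (hA.mul ih).intervalIntegrable a b) 0

lemma hasDerivAt_peanoBaker_succ [CompleteSpace 𝔸] {A : ℝ → 𝔸} (hA : Continuous A) (n : ℕ) (t : ℝ) :
    HasDerivAt (peanoBaker A (n + 1)) (A t * peanoBaker A n t) t :=
  (hA.mul (continuous_peanoBaker hA n)).integral_hasStrictDerivAt 0 t |>.hasDerivAt

lemma norm_peanoBaker_le {A : ℝ → 𝔸} (hA : Continuous A) {K : ℝ} (hK : ∀ s, ‖A s‖ ≤ K)
    (n : ℕ) (t : ℝ) : ‖peanoBaker A n t‖ ≤ (K * |t|) ^ n / n.factorial * ‖(1 : 𝔸)‖ := by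
  have hK0 : 0 ≤ K := (norm_nonneg _).trans (hK 0)
  induction n generalizing t with
  | zero => simp [peanoBaker]
  | succ n ih =>
    -- The majorant is written with `|s - 0|` to fit `integral_pow_abs_sub_uIoc`; absolute values
    -- cover negative `t`.
    have hpow : Continuous fun s : ℝ => (K ^ (n + 1) / n.factorial * ‖(1 : 𝔸)‖) * |s - 0| ^ n := by fun_prop
    calc ‖peanoBaker A (n + 1) t‖
        ≤ ∫ s in uIoc 0 t, ‖A s * peanoBaker A n s‖ :=
          intervalIntegral.norm_integral_le_integral_norm_uIoc
      _ ≤ ∫ s in uIoc 0 t, (K ^ (n + 1) / n.factorial * ‖(1 : 𝔸)‖) * |s - 0| ^ n := by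
          refine setIntegral_mono_on ?_ ?_ measurableSet_uIoc fun s _ => ?_
          · exact ((hA.mul (continuous_peanoBaker hA n)).norm.intervalIntegrable 0 t).def'
          · exact (hpow.intervalIntegrable 0 t).def'
          · calc ‖A s * peanoBaker A n s‖ ≤ ‖A s‖ * ‖peanoBaker A n s‖ := norm_mul_le _ _
              _ ≤ K * ((K * |s|) ^ n / n.factorial * ‖(1 : 𝔸)‖) := by gcongr; exacts [hK s, ih s]
              _ = _ := by rw [sub_zero, mul_pow]; ring
      _ = (K * |t|) ^ (n + 1) / (n + 1).factorial * ‖(1 : 𝔸)‖ := by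
          rw [integral_const_mul, integral_pow_abs_sub_uIoc, Nat.factorial_succ, mul_pow, sub_zero]
          push_cast
          field_simp

/-- A linear differential equation with bounded continuous coefficients has a fundamental
solution. -/
theorem exists_hasDerivAt_linear [CompleteSpace 𝔸] {A : ℝ → 𝔸} (hA : Continuous A) {K : ℝ} (hK : ∀ s, ‖A s‖ ≤ K) :
    ∃ Φ : ℝ → 𝔸, Φ 0 = 1 ∧ ∀ t, HasDerivAt Φ (A t * Φ t) t := by
  have hK0 : 0 ≤ K := (norm_nonneg _).trans (hK 0)
  have hsum (t : ℝ) : Summable fun n => peanoBaker A n t :=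
    .of_norm_bounded ((Real.summable_pow_div_factorial (K * |t|)).mul_right _)
      fun n => norm_peanoBaker_le hA hK n t
  have hsplit (t : ℝ) : ∑' n, peanoBaker A n t = 1 + ∑' n, peanoBaker A (n + 1) t :=
    (hsum t).tsum_eq_zero_add
  refine ⟨fun t => ∑' n, peanoBaker A n t, ?_, fun t => ?_⟩
  · simp [hsplit, peanoBaker]
  -- Termwise differentiation needs derivative bounds summable uniformly on an open interval, and
  -- summability at one of its points; this interval contains both `t` and `0`. The constant term is
  -- split off, so the derivatives of the remaining terms resum to `A t * Φ t`.
  · have hR : t ∈ Ioo (-(|t| + 1)) (|t| + 1) := abs_lt.1 (lt_add_one _)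
    have h0 : (0 : ℝ) ∈ Ioo (-(|t| + 1)) (|t| + 1) := abs_lt.1 (by rw [abs_zero]; positivity)
    have hbound (n : ℕ) (y : ℝ) (hy : y ∈ Ioo (-(|t| + 1)) (|t| + 1)) :
        ‖A y * peanoBaker A n y‖ ≤ K * ((K * (|t| + 1)) ^ n / n.factorial * ‖(1 : 𝔸)‖) := by
      have hy' : |y| ≤ |t| + 1 := (abs_lt.2 hy).le
      have hn : ‖peanoBaker A n y‖ ≤ (K * (|t| + 1)) ^ n / n.factorial * ‖(1 : 𝔸)‖ :=
        (norm_peanoBaker_le hA hK n y).trans (by gcongr)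
      exact (norm_mul_le _ _).trans (mul_le_mul (hK y) hn (norm_nonneg _) hK0)
    have key := hasDerivAt_tsum_of_isPreconnected
      (((Real.summable_pow_div_factorial (K * (|t| + 1))).mul_right _).mul_left K)
      isOpen_Ioo isPreconnected_Ioo
      (fun n y _ => hasDerivAt_peanoBaker_succ hA n y) hbound h0
      ((summable_nat_add_iff 1).2 (hsum 0)) hR
    rw [(hsum t).tsum_mul_left] at key
    exact (key.const_add 1).congr_of_eventuallyEq (Eventually.of_forall hsplit)

end LinearODE

/-! ### Derivative of the determinant -/

section Det

/-- Jacobi's formula along a solution of a linear differential equation (Liouville). -/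
theorem hasDerivWithinAt_matrix_det {n : Type*} [Fintype n] [DecidableEq n]
    {M : ℝ → Matrix n n ℝ} {A : Matrix n n ℝ} {s : Set ℝ} {t : ℝ}
    (hM : ∀ i j, HasDerivWithinAt (fun r => M r i j) ((A * M t) i j) s t) :
    HasDerivWithinAt (fun r => (M r).det) (A.trace * (M t).det) s t := by
  have hrow : HasDerivWithinAt M (A * M t) s t :=
    hasDerivWithinAt_pi.2 fun i => hasDerivWithinAt_pi.2 fun j => hM i j
  let d : ContinuousMultilinearMap ℝ (fun _ : n => n → ℝ) ℝ :=
    { (Matrix.detRowAlternating (R := ℝ) (n := n)).toMultilinearMap with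
      cont := by
        change Continuous fun M : Matrix n n ℝ => M.det
        exact continuous_id.matrix_det }
  have h := (d.hasFDerivAt (M t)).comp_hasDerivWithinAt t hrow
  refine (h.congr_deriv ?_)
  refine (ContinuousMultilinearMap.linearDeriv_apply d (M t) (A * M t)).trans ?_
  -- The derivative is a sum over `i` of determinants with row `i` replaced by row `i` of `A * M t`.
  -- That row is a combination of the rows of `M t`, and only its multiple `A i i` of row `i` itself
  -- contributes.
  rw [Matrix.trace, Finset.sum_mul]
  refine Finset.sum_congr rfl fun i _ => ?_
  have : (A * M t) i = ∑ k, A i k • (M t) k := by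
    ext j; simp [Matrix.mul_apply]
  rw [this]
  exact Matrix.det_updateRow_sum (M t) i (A i)

variable {E : Type*} [NormedAddCommGroup E] [NormedSpace ℝ E] [FiniteDimensional ℝ E]

theorem hasDerivWithinAt_det_of_linear {Φ : ℝ → E →L[ℝ] E} {A : E →L[ℝ] E} {s : Set ℝ} {t : ℝ}
    (h : HasDerivWithinAt Φ (A * Φ t) s t) :
    HasDerivWithinAt (fun r => (Φ r).det) (LinearMap.trace ℝ E A.toLinearMap * (Φ t).det) s t := by
  let b := Module.finBasis ℝ E
  have hdet (r : ℝ) : (Φ r).det = (LinearMap.toMatrix b b (Φ r).toLinearMap).det :=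
    (LinearMap.det_toMatrix b _).symm
  simp_rw [hdet, LinearMap.trace_eq_matrix_trace ℝ b]
  refine hasDerivWithinAt_matrix_det fun i j => ?_
  have happ : HasDerivWithinAt (fun r => Φ r (b j)) ((A * Φ t) (b j)) s t := by
    simpa using h.clm_apply (hasDerivWithinAt_const t s (b j))
  have := (LinearMap.toContinuousLinearMap (b.coord i)).hasFDerivAt.comp_hasDerivWithinAt t happ
  refine (this.congr_deriv ?_).congr (fun r _ => ?_) ?_
  · rw [← LinearMap.toMatrix_mul, LinearMap.toMatrix_apply]; rfl
  · rw [LinearMap.toMatrix_apply]; rfl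
  · rw [LinearMap.toMatrix_apply]; rfl

end Det

end LFIS

namespace LFIS

/-! ### Regularity of the flow in its starting point -/

section Flow

open Metric

variable {D : ℕ} {v x : ℝ → EuclideanSpace ℝ (Fin D) → EuclideanSpace ℝ (Fin D)}

/-- The spatial derivative is bounded on the compact set `[0,1] × closedBall 0 R`. No global
Lipschitz bound is assumed, so later estimates must keep trajectories in a ball. -/
lemma IsVelocityField.exists_lipschitzOnWith (hv : IsVelocityField v) (R : ℝ) :
    ∃ K : NNReal, ∀ s ∈ Icc (0 : ℝ) 1, LipschitzOnWith K (v s) (closedBall 0 R) := by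
  obtain ⟨C, hC⟩ := (isCompact_Icc.prod (isCompact_closedBall (0 : EuclideanSpace ℝ (Fin D)) R)
    ).exists_bound_of_continuousOn (hv.continuousOn_fderiv.mono (prod_mono_right (subset_univ _)))
  refine ⟨C.toNNReal, fun s hs => ?_⟩
  refine (convex_closedBall _ _).lipschitzOnWith_of_nnnorm_fderiv_le
    (fun y _ => hv.differentiable s hs y) fun y hy => ?_
  rw [← NNReal.coe_le_coe, coe_nnnorm]
  exact (hC (s, y) ⟨hs, hy⟩).trans (Real.le_coe_toNNReal C)

namespace IsFlow

lemma continuousOn_time (hx : IsFlow v x) (x₀ : EuclideanSpace ℝ (Fin D)) :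
    ContinuousOn (fun s => x s x₀) (Icc 0 1) :=
  fun s hs => (hx.ode x₀ s hs).continuousWithinAt

lemma hasDerivWithinAt_Ici (hx : IsFlow v x) (x₀ : EuclideanSpace ℝ (Fin D)) {s : ℝ}
    (hs : s ∈ Ico (0 : ℝ) 1) : HasDerivWithinAt (fun s => x s x₀) (v s (x s x₀)) (Ici s) s :=
  (hx.ode x₀ s (Ico_subset_Icc_self hs)).mono_of_mem_nhdsWithin (Icc_mem_nhdsGE_of_mem hs)

lemma hasDerivWithinAt_Iic (hx : IsFlow v x) (x₀ : EuclideanSpace ℝ (Fin D)) {s : ℝ}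
    (hs : s ∈ Ioc (0 : ℝ) 1) : HasDerivWithinAt (fun s => x s x₀) (v s (x s x₀)) (Iic s) s :=
  (hx.ode x₀ s (Ioc_subset_Icc_self hs)).mono_of_mem_nhdsWithin (Icc_mem_nhdsLE_of_mem hs)

lemma exists_bound (hx : IsFlow v x) (x₀ : EuclideanSpace ℝ (Fin D)) :
    ∃ R : ℝ, ∀ s ∈ Icc (0 : ℝ) 1, x s x₀ ∈ closedBall (0 : EuclideanSpace ℝ (Fin D)) R := by
  obtain ⟨R, hR⟩ := isCompact_Icc.exists_bound_of_continuousOn (hx.continuousOn_time x₀)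
  exact ⟨R, fun s hs => mem_closedBall_zero_iff.2 (hR s hs)⟩

/-- Trajectories depend in a locally Lipschitz way on the starting point, uniformly in time. -/
lemma exists_norm_sub_le (hv : IsVelocityField v) (hx : IsFlow v x)
    (x₀ : EuclideanSpace ℝ (Fin D)) :
    ∃ C > 0, ∃ δ > 0, ∀ x₁, ‖x₁ - x₀‖ ≤ δ → ∀ s ∈ Icc (0 : ℝ) 1,
      ‖x s x₁ - x s x₀‖ ≤ C * ‖x₁ - x₀‖ := by
  obtain ⟨R, hR⟩ := hx.exists_bound x₀
  obtain ⟨K, hK⟩ := hv.exists_lipschitzOnWith (R + 1)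
  -- `K` is the Lipschitz constant on the ball of radius `R + 1`. The choice of `δ` keeps the
  -- barrier `‖x₁ - x₀‖ e^{(K+1)r}` at most `1`, and the rate `K + 1` makes it grow strictly faster
  -- than the distance at any contact time. Containment in the ball is needed only at such times.
  refine ⟨Real.exp (K + 1), Real.exp_pos _, Real.exp (-(K + 1)), Real.exp_pos _, ?_⟩
  intro x₁ hx₁ s hs
  rcases eq_or_ne x₁ x₀ with rfl | hne
  · simp
  have hd : 0 < ‖x₁ - x₀‖ := norm_pos_iff.2 (sub_ne_zero.2 hne)
  have hle {r : ℝ} (hr : r ≤ 1) : (K + 1) * r ≤ (K : ℝ) + 1 := by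
    nlinarith [K.coe_nonneg]
  have hB (r : ℝ) : HasDerivAt (fun r => ‖x₁ - x₀‖ * Real.exp ((K + 1) * r))
      ((K + 1) * (‖x₁ - x₀‖ * Real.exp ((K + 1) * r))) r := by
    have := (((hasDerivAt_id r).const_mul ((K : ℝ) + 1)).exp).const_mul ‖x₁ - x₀‖
    refine this.congr_deriv ?_
    simp only [id]; ring
  have key := image_norm_le_of_norm_deriv_right_lt_deriv_boundary
    ((hx.continuousOn_time x₁).sub (hx.continuousOn_time x₀))
    (fun r hr => (hx.hasDerivWithinAt_Ici x₁ hr).sub (hx.hasDerivWithinAt_Ici x₀ hr))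
    (B := fun r => ‖x₁ - x₀‖ * Real.exp ((K + 1) * r))
    (by simp [hx.init]) hB ?_ hs
  · refine key.trans ?_
    rw [mul_comm]
    gcongr
    exact hle hs.2
  · intro r hr heq
    have hr' := Ico_subset_Icc_self hr
    simp only [Pi.sub_apply] at heq
    have h1 : ‖x r x₁ - x r x₀‖ ≤ 1 := by
      rw [heq]
      calc ‖x₁ - x₀‖ * Real.exp ((K + 1) * r)
          ≤ Real.exp (-(K + 1)) * Real.exp (K + 1) := by gcongr; exact hle hr'.2
        _ = 1 := by rw [← Real.exp_add]; simp
    have h0 := mem_closedBall_zero_iff.1 (hR r hr')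
    have m0 : x r x₀ ∈ closedBall (0 : EuclideanSpace ℝ (Fin D)) (R + 1) :=
      mem_closedBall_zero_iff.2 (by linarith)
    have m1 : x r x₁ ∈ closedBall (0 : EuclideanSpace ℝ (Fin D)) (R + 1) := by
      refine mem_closedBall_zero_iff.2 ?_
      have := norm_add_le (x r x₁ - x r x₀) (x r x₀)
      rw [sub_add_cancel] at this
      linarith
    have hpos : 0 < ‖x₁ - x₀‖ * Real.exp ((K + 1) * r) := by positivity
    calc ‖v r (x r x₁) - v r (x r x₀)‖ ≤ K * ‖x r x₁ - x r x₀‖ :=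
          (hK r hr').norm_sub_le m1 m0
      _ < (K + 1) * (‖x₁ - x₀‖ * Real.exp ((K + 1) * r)) := by rw [heq]; linarith

/-- Continuity in time along one trajectory combines with the Lipschitz bound in the starting point,
which is uniform in time. -/
lemma continuousOn (hv : IsVelocityField v) (hx : IsFlow v x) :
    ContinuousOn (fun p : ℝ × EuclideanSpace ℝ (Fin D) => x p.1 p.2) (Icc 0 1 ×ˢ univ) := by
  rintro ⟨s₀, x₀⟩ ⟨hs₀, -⟩
  obtain ⟨C, hC, δ, hδ, h⟩ := exists_norm_sub_le hv hx x₀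
  have h1 : Tendsto (fun p : ℝ × EuclideanSpace ℝ (Fin D) => x p.1 x₀)
      (𝓝[Icc 0 1 ×ˢ univ] (s₀, x₀)) (𝓝 (x s₀ x₀)) :=
    (hx.continuousOn_time x₀ s₀ hs₀).tendsto.comp
      (continuous_fst.continuousWithinAt.tendsto_nhdsWithin fun p hp => hp.1)
  have h2 : Tendsto (fun p : ℝ × EuclideanSpace ℝ (Fin D) => x p.1 p.2 - x p.1 x₀)
      (𝓝[Icc 0 1 ×ˢ univ] (s₀, x₀)) (𝓝 0) := by
    have hlim : Tendsto (fun p : ℝ × EuclideanSpace ℝ (Fin D) => C * ‖p.2 - x₀‖)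
        (𝓝[Icc 0 1 ×ˢ univ] (s₀, x₀)) (𝓝 0) := by
      have : Continuous fun p : ℝ × EuclideanSpace ℝ (Fin D) => C * ‖p.2 - x₀‖ := by fun_prop
      simpa using (this.tendsto (s₀, x₀)).mono_left nhdsWithin_le_nhds
    refine squeeze_zero_norm' ?_ hlim
    have hnear : ∀ᶠ p : ℝ × EuclideanSpace ℝ (Fin D) in 𝓝[Icc 0 1 ×ˢ univ] (s₀, x₀),
        ‖p.2 - x₀‖ < δ := by
      have : Continuous fun p : ℝ × EuclideanSpace ℝ (Fin D) => ‖p.2 - x₀‖ := by fun_prop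
      exact nhdsWithin_le_nhds (this.continuousAt.eventually_lt continuousAt_const (by simpa))
    filter_upwards [hnear, self_mem_nhdsWithin] with p hp hmem
    exact h p.2 hp.le p.1 hmem.1
  have := h2.add h1
  simpa [ContinuousWithinAt] using this

/-- Trajectories that meet at time `s` agree backwards in time, hence at time `0`. -/
lemma injective (hv : IsVelocityField v) (hx : IsFlow v x) {s : ℝ} (hs : s ∈ Icc (0 : ℝ) 1) :
    Function.Injective (x s) := by
  intro a b hab
  obtain ⟨Ra, hRa⟩ := hx.exists_bound a
  obtain ⟨Rb, hRb⟩ := hx.exists_bound b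
  obtain ⟨K, hK⟩ := hv.exists_lipschitzOnWith (max Ra Rb)
  have hsub : Icc 0 s ⊆ Icc (0 : ℝ) 1 := Icc_subset_Icc_right hs.2
  have hsub' : Ioc 0 s ⊆ Icc (0 : ℝ) 1 := Ioc_subset_Icc_self.trans hsub
  have := ODE_solution_unique_of_mem_Icc_left (v := v) (K := K) (a := 0) (b := s)
    (s := fun _ => closedBall 0 (max Ra Rb)) (fun r hr => hK r (hsub' hr))
    ((hx.continuousOn_time a).mono hsub)
    (fun r hr => hx.hasDerivWithinAt_Iic a ⟨hr.1, (hsub' hr).2⟩)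
    (fun r hr => closedBall_subset_closedBall (le_max_left _ _) (hRa r (hsub' hr)))
    ((hx.continuousOn_time b).mono hsub)
    (fun r hr => hx.hasDerivWithinAt_Iic b ⟨hr.1, (hsub' hr).2⟩)
    (fun r hr => closedBall_subset_closedBall (le_max_right _ _) (hRb r (hsub' hr))) hab
  simpa [hx.init] using this (left_mem_Icc.2 hs.1)

/-- The linearization of `v` along a trajectory approximates `v` near it, uniformly in time. -/
lemma exists_linearization (hv : IsVelocityField v) (hx : IsFlow v x)
    (x₀ : EuclideanSpace ℝ (Fin D)) {η : ℝ} (hη : 0 < η) :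
    ∃ r > 0, ∀ s ∈ Icc (0 : ℝ) 1, ∀ y, ‖y - x s x₀‖ ≤ r →
      ‖v s y - v s (x s x₀) - fderiv ℝ (v s) (x s x₀) (y - x s x₀)‖ ≤ η * ‖y - x s x₀‖ := by
  obtain ⟨R, hR⟩ := hx.exists_bound x₀
  have huc := (isCompact_Icc.prod (isCompact_closedBall (0 : EuclideanSpace ℝ (Fin D)) (R + 1))
    ).uniformContinuousOn_of_continuous
      (hv.continuousOn_fderiv.mono (prod_mono_right (subset_univ _)))
  obtain ⟨r, hr, h⟩ := Metric.uniformContinuousOn_iff_le.1 huc η hη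
  refine ⟨min r 1, by positivity, fun s hs y hy => ?_⟩
  have h0 := mem_closedBall_zero_iff.1 (hR s hs)
  -- Mean value inequality for `v s` minus its linearization; uniform continuity of the derivative
  -- makes `r` independent of `s`.
  refine (convex_closedBall (x s x₀) (min r 1)).norm_image_sub_le_of_norm_hasFDerivWithin_le'
    (fun z _ => (hv.differentiable s hs z).hasFDerivAt.hasFDerivWithinAt) (fun z hz => ?_)
    (mem_closedBall_self (by positivity)) (mem_closedBall_iff_norm.2 hy)
  have hz' := mem_closedBall_iff_norm.1 hz
  have m0 : x s x₀ ∈ closedBall (0 : EuclideanSpace ℝ (Fin D)) (R + 1) :=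
    mem_closedBall_zero_iff.2 (by linarith)
  have m1 : z ∈ closedBall (0 : EuclideanSpace ℝ (Fin D)) (R + 1) := by
    refine mem_closedBall_zero_iff.2 ?_
    have := norm_add_le (z - x s x₀) (x s x₀)
    rw [sub_add_cancel] at this
    linarith [min_le_right r 1]
  have := h (s, z) ⟨hs, m1⟩ (s, x s x₀) ⟨hs, m0⟩ (by
    rw [Prod.dist_eq, dist_self, max_eq_right dist_nonneg, dist_eq_norm]
    exact hz'.trans (min_le_left _ _))
  rwa [dist_eq_norm] at this

/-- The flow is differentiable in the starting point, and its derivative solves the linearized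
equation. -/
theorem exists_hasFDerivAt (hv : IsVelocityField v) (hx : IsFlow v x)
    (x₀ : EuclideanSpace ℝ (Fin D)) :
    ∃ Φ : ℝ → EuclideanSpace ℝ (Fin D) →L[ℝ] EuclideanSpace ℝ (Fin D), Φ 0 = 1 ∧
      ∀ s ∈ Icc (0 : ℝ) 1,
        HasDerivWithinAt Φ (fderiv ℝ (v s) (x s x₀) * Φ s) (Icc 0 1) s ∧
        HasFDerivAt (x s) (Φ s) x₀ := by
  set A : ℝ → EuclideanSpace ℝ (Fin D) →L[ℝ] EuclideanSpace ℝ (Fin D) :=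
    fun s => fderiv ℝ (v s) (x s x₀) with hAdef
  have hA : ContinuousOn A (Icc 0 1) :=
    hv.continuousOn_fderiv.comp (continuousOn_id.prodMk (hx.continuousOn_time x₀))
      fun s hs => ⟨hs, mem_univ _⟩
  obtain ⟨K, hK⟩ := isCompact_Icc.exists_bound_of_continuousOn hA
  -- Freezing the coefficient outside `[0,1]` gives a bounded continuous function on the whole line.
  have hext : Continuous (IccExtend zero_le_one ((Icc (0 : ℝ) 1).domRestrict A)) :=
    hA.domRestrict.Icc_extend'
  obtain ⟨Φ, hΦ0, hΦ⟩ := exists_hasDerivAt_linear hext (K := K)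
    fun s => hK _ (projIcc (0 : ℝ) 1 zero_le_one s).2
  have hΦ' : ∀ s ∈ Icc (0 : ℝ) 1, HasDerivAt Φ (A s * Φ s) s := fun s hs => by
    have := hΦ s
    rwa [IccExtend_of_mem _ _ hs] at this
  refine ⟨Φ, hΦ0, fun s hs => ⟨(hΦ' s hs).hasDerivWithinAt, ?_⟩⟩
  obtain ⟨C, hC, δ, hδ, hLip⟩ := exists_norm_sub_le hv hx x₀
  have hK0 : 0 ≤ K := (norm_nonneg _).trans (hK 0 (by simp))
  set c : ℝ := gronwallBound 0 K 1 1 with hc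
  have hgron (ε r : ℝ) : gronwallBound 0 K ε r = ε * gronwallBound 0 K 1 r := by
    unfold gronwallBound; split_ifs <;> ring
  have hc0 : 0 ≤ c := by
    have := gronwallBound_mono (δ := 0) (ε := 1) le_rfl zero_le_one hK0 (zero_le_one' ℝ)
    rwa [gronwallBound_x0] at this
  rw [hasFDerivAt_iff_isLittleO, Asymptotics.isLittleO_iff]
  intro ε hε
  -- The remainder `x s x₁ - x s x₀ - Φ s (x₁ - x₀)` solves the linearized equation with a defect of
  -- at most `η C ‖x₁ - x₀‖`. Grönwall multiplies the defect by at most `c`; using `c + 1` avoids a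
  -- zero divisor.
  have hη : 0 < ε / (C * (c + 1)) := by positivity
  obtain ⟨r, hr, hlin⟩ := exists_linearization hv hx x₀ hη
  have hnear : ∀ᶠ x₁ in 𝓝 x₀, ‖x₁ - x₀‖ < min δ (r / C) := by
    have : Continuous fun y : EuclideanSpace ℝ (Fin D) => ‖y - x₀‖ := by fun_prop
    exact this.continuousAt.eventually_lt continuousAt_const (by simp [hδ, div_pos hr hC])
  filter_upwards [hnear] with x₁ hx₁
  have hx₁δ : ‖x₁ - x₀‖ ≤ δ := hx₁.le.trans (min_le_left _ _)
  have hx₁r : C * ‖x₁ - x₀‖ ≤ r := by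
    have := hx₁.le.trans (min_le_right _ _)
    rwa [le_div_iff₀ hC, mul_comm] at this
  have hΦc : ContinuousOn (fun s => Φ s (x₁ - x₀)) (Icc 0 1) := fun s hs =>
    ((hΦ s).continuousAt.clm_apply continuousAt_const).continuousWithinAt
  have key := norm_le_gronwallBound_of_norm_deriv_right_le (a := 0) (b := 1) (δ := 0) (K := K)
    (ε := ε / (c + 1) * ‖x₁ - x₀‖)
    (((hx.continuousOn_time x₁).sub (hx.continuousOn_time x₀)).sub hΦc)
    (fun q hq => ((hx.hasDerivWithinAt_Ici x₁ hq).sub (hx.hasDerivWithinAt_Ici x₀ hq)).sub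
      ((hΦ' q (Ico_subset_Icc_self hq)).clm_apply
        (hasDerivAt_const q (x₁ - x₀))).hasDerivWithinAt)
    (by simp [hx.init, hΦ0]) ?_ s hs
  · refine key.trans ?_
    rw [hgron, sub_zero]
    have h1 : gronwallBound 0 K 1 s ≤ c := gronwallBound_mono le_rfl zero_le_one hK0 hs.2
    calc ε / (c + 1) * ‖x₁ - x₀‖ * gronwallBound 0 K 1 s
        ≤ ε / (c + 1) * ‖x₁ - x₀‖ * (c + 1) := by gcongr; linarith
      _ = ε * ‖x₁ - x₀‖ := by field_simp
  · intro q hq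
    have hq' := Ico_subset_Icc_self hq
    have hd := hLip x₁ hx₁δ q hq'
    have h1 := hlin q hq' (x q x₁) (hd.trans hx₁r)
    have h2 : ε / (C * (c + 1)) * ‖x q x₁ - x q x₀‖ ≤ ε / (c + 1) * ‖x₁ - x₀‖ := by
      calc ε / (C * (c + 1)) * ‖x q x₁ - x q x₀‖
          ≤ ε / (C * (c + 1)) * (C * ‖x₁ - x₀‖) := by gcongr
        _ = ε / (c + 1) * ‖x₁ - x₀‖ := by field_simp
    have h3 := (A q).le_of_opNorm_le (hK q hq') (x q x₁ - x q x₀ - Φ q (x₁ - x₀))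
    have h4 : v q (x q x₁) - v q (x q x₀) - ((A q * Φ q) (x₁ - x₀) + Φ q 0) =
        (v q (x q x₁) - v q (x q x₀) - A q (x q x₁ - x q x₀)) +
          A q (x q x₁ - x q x₀ - Φ q (x₁ - x₀)) := by
      simp
    rw [h4]
    refine (norm_add_le _ _).trans ?_
    simp only [Pi.sub_apply]
    linarith

end IsFlow

end Flow

end LFIS

namespace LFIS

/-! ### The density path and its partition function -/

section Density

variable {D : ℕ} {ρ : ℝ → EuclideanSpace ℝ (Fin D) → ℝ}

/-- The joint derivative of the density path in time and space. -/
noncomputable def densityFDeriv (ρ : ℝ → EuclideanSpace ℝ (Fin D) → ℝ) :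
    ℝ × EuclideanSpace ℝ (Fin D) → (ℝ × EuclideanSpace ℝ (Fin D) →L[ℝ] ℝ) :=
  fderivWithin ℝ (fun p : ℝ × EuclideanSpace ℝ (Fin D) => ρ p.1 p.2) (Icc 0 1 ×ˢ univ)

namespace IsDensityPath

lemma continuousOn_densityFDeriv (hρ : IsDensityPath ρ) :
    ContinuousOn (densityFDeriv ρ) (Icc 0 1 ×ˢ univ) :=
  hρ.contDiffOn.continuousOn_fderivWithin (uniqueDiffOn_Icc_zero_one.prod uniqueDiffOn_univ) le_rfl

lemma hasFDerivWithinAt (hρ : IsDensityPath ρ) {s : ℝ} (hs : s ∈ Icc (0 : ℝ) 1)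
    (y : EuclideanSpace ℝ (Fin D)) :
    HasFDerivWithinAt (fun p : ℝ × EuclideanSpace ℝ (Fin D) => ρ p.1 p.2) (densityFDeriv ρ (s, y))
      (Icc 0 1 ×ˢ univ) (s, y) :=
  (hρ.contDiffOn.differentiableOn one_ne_zero (s, y) ⟨hs, mem_univ _⟩).hasFDerivWithinAt

lemma hasDerivWithinAt_comp (hρ : IsDensityPath ρ) {c : ℝ → EuclideanSpace ℝ (Fin D)}
    {c' : EuclideanSpace ℝ (Fin D)} {s : ℝ} (hs : s ∈ Icc (0 : ℝ) 1)
    (hc : HasDerivWithinAt c c' (Icc 0 1) s) :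
    HasDerivWithinAt (fun r => ρ r (c r)) (densityFDeriv ρ (s, c s) (1, c')) (Icc 0 1) s :=
  HasFDerivWithinAt.comp_hasDerivWithinAt (f := fun r => (r, c r)) s
    (hρ.hasFDerivWithinAt hs (c s)) ((hasDerivWithinAt_id s _).prodMk hc)
    fun _ hr => ⟨hr, mem_univ _⟩

lemma hasFDerivAt (hρ : IsDensityPath ρ) {s : ℝ} (hs : s ∈ Icc (0 : ℝ) 1)
    (y : EuclideanSpace ℝ (Fin D)) :
    HasFDerivAt (ρ s)
      ((densityFDeriv ρ (s, y)).comp (ContinuousLinearMap.inr ℝ ℝ (EuclideanSpace ℝ (Fin D)))) y := by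
  rw [← hasFDerivWithinAt_univ]
  exact (hρ.hasFDerivWithinAt hs y).comp y (hasFDerivAt_prodMk_right s y).hasFDerivWithinAt
    fun _ _ => ⟨hs, mem_univ _⟩

lemma continuous (hρ : IsDensityPath ρ) {s : ℝ} (hs : s ∈ Icc (0 : ℝ) 1) : Continuous (ρ s) :=
  continuous_iff_continuousAt.2 fun y => (hρ.hasFDerivAt hs y).continuousAt

lemma partitionFn_pos (hρ : IsDensityPath ρ) {s : ℝ} (hs : s ∈ Icc (0 : ℝ) 1) :
    0 < partitionFn ρ s := by
  rw [partitionFn, integral_pos_iff_support_of_nonneg (fun y => (hρ.pos s hs y).le)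
    (hρ.integrable s hs)]
  have : Function.support (ρ s) = univ :=
    eq_univ_of_forall fun y => (hρ.pos s hs y).ne'
  rw [this]
  exact isOpen_univ.measure_pos volume univ_nonempty

lemma hasDerivWithinAt_log (hρ : IsDensityPath ρ) {s : ℝ} (hs : s ∈ Icc (0 : ℝ) 1)
    (y : EuclideanSpace ℝ (Fin D)) :
    HasDerivWithinAt (fun r => Real.log (ρ r y)) (densityFDeriv ρ (s, y) (1, 0) / ρ s y)
      (Icc 0 1) s :=
  (hρ.hasDerivWithinAt_comp hs (hasDerivWithinAt_const s _ y)).log (hρ.pos s hs y).ne'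

lemma dtLog_eq (hρ : IsDensityPath ρ) {s : ℝ} (hs : s ∈ Icc (0 : ℝ) 1)
    (y : EuclideanSpace ℝ (Fin D)) : dtLog ρ s y = densityFDeriv ρ (s, y) (1, 0) / ρ s y :=
  (hρ.hasDerivWithinAt_log hs y).derivWithin (uniqueDiffOn_Icc_zero_one s hs)

lemma densityFDeriv_time (hρ : IsDensityPath ρ) {s : ℝ} (hs : s ∈ Icc (0 : ℝ) 1)
    (y : EuclideanSpace ℝ (Fin D)) : densityFDeriv ρ (s, y) (1, 0) = dtLog ρ s y * ρ s y := by
  rw [hρ.dtLog_eq hs, div_mul_cancel₀ _ (hρ.pos s hs y).ne']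

/-- The factor `Z(s)` is constant in space, so it drops out of the score. -/
lemma inner_score (hρ : IsDensityPath ρ) {s : ℝ} (hs : s ∈ Icc (0 : ℝ) 1)
    (y w : EuclideanSpace ℝ (Fin D)) :
    inner ℝ (score ρ s y) w = densityFDeriv ρ (s, y) (0, w) / ρ s y := by
  have hZ := (hρ.partitionFn_pos hs).ne'
  have hy := (hρ.pos s hs y).ne'
  have h : HasFDerivAt (fun z => Real.log (targetDensity ρ s z)) _ y :=
    ((hρ.hasFDerivAt hs y).mul_const (partitionFn ρ s)⁻¹).log (mul_ne_zero hy (inv_ne_zero hZ))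
  rw [score, gradient, InnerProductSpace.toDual_symm_apply, h.fderiv]
  simp
  field_simp

lemma continuousOn_density (hρ : IsDensityPath ρ) :
    ContinuousOn (fun p : ℝ × EuclideanSpace ℝ (Fin D) => ρ p.1 p.2) (Icc 0 1 ×ˢ univ) :=
  hρ.contDiffOn.continuousOn

lemma continuousOn_dtLog (hρ : IsDensityPath ρ) :
    ContinuousOn (fun p : ℝ × EuclideanSpace ℝ (Fin D) => dtLog ρ p.1 p.2) (Icc 0 1 ×ˢ univ) := by
  refine ContinuousOn.congr (f := fun p => densityFDeriv ρ p (1, 0) / ρ p.1 p.2) ?_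
    fun p hp => hρ.dtLog_eq hp.1 p.2
  exact (hρ.continuousOn_densityFDeriv.clm_apply continuousOn_const).div hρ.continuousOn_density
    fun p hp => (hρ.pos p.1 hp.1 p.2).ne'

lemma continuous_dtLog (hρ : IsDensityPath ρ) {s : ℝ} (hs : s ∈ Icc (0 : ℝ) 1) :
    Continuous (dtLog ρ s) :=
  hρ.continuousOn_dtLog.comp_continuous (Continuous.prodMk_right s) fun _ => ⟨hs, mem_univ _⟩

lemma integral_targetMeasure (hρ : IsDensityPath ρ) {s : ℝ} (hs : s ∈ Icc (0 : ℝ) 1)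
    (f : EuclideanSpace ℝ (Fin D) → ℝ) :
    ∫ y, f y ∂(targetMeasure ρ s) = ∫ y, ρ s y / partitionFn ρ s * f y := by
  have hZ := hρ.partitionFn_pos hs
  rw [targetMeasure, integral_withDensity_eq_integral_toReal_smul]
  · refine integral_congr_ae (Eventually.of_forall fun y => ?_)
    simp only [targetDensity, smul_eq_mul]
    rw [ENNReal.toReal_ofReal (div_nonneg (hρ.pos s hs y).le hZ.le)]
  · exact ((hρ.continuous hs).div_const _).measurable.ennreal_ofReal
  · exact Eventually.of_forall fun y => ENNReal.ofReal_lt_top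

lemma integral_one_targetMeasure (hρ : IsDensityPath ρ) {s : ℝ} (hs : s ∈ Icc (0 : ℝ) 1) :
    ∫ _, (1 : ℝ) ∂(targetMeasure ρ s) = 1 := by
  rw [hρ.integral_targetMeasure hs]
  simp only [mul_one]
  rw [integral_div]
  exact div_self (hρ.partitionFn_pos hs).ne'

variable {t M : ℝ}

/-- Along a path with `|∂ₜ log ρ| ≤ M`, the density grows at most exponentially. -/
lemma density_le (hρ : IsDensityPath ρ) (ht : t ∈ Icc (0 : ℝ) 1)
    (hM : ∀ s ∈ Icc 0 t, ∀ y, |dtLog ρ s y| ≤ M) {s : ℝ} (hs : s ∈ Icc 0 t)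
    (y : EuclideanSpace ℝ (Fin D)) : ρ s y ≤ Real.exp M * ρ 0 y := by
  have hsub : Icc 0 t ⊆ Icc (0 : ℝ) 1 := Icc_subset_Icc_right ht.2
  have h0 : (0 : ℝ) ∈ Icc 0 t := left_mem_Icc.2 ht.1
  have hM0 : 0 ≤ M := (abs_nonneg _).trans (hM 0 h0 y)
  have key := (convex_Icc 0 t).norm_image_sub_le_of_norm_hasDerivWithin_le
    (fun r hr => (hρ.hasDerivWithinAt_log (hsub hr) y).mono hsub)
    (fun r hr => by rw [← hρ.dtLog_eq (hsub hr)]; exact hM r hr y) h0 hs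
  rw [sub_zero, Real.norm_eq_abs, Real.norm_eq_abs, abs_of_nonneg hs.1] at key
  have h1 : Real.log (ρ s y) ≤ M + Real.log (ρ 0 y) := by
    have := (le_abs_self _).trans key
    nlinarith [(hsub hs).2]
  calc ρ s y = Real.exp (Real.log (ρ s y)) := (Real.exp_log (hρ.pos s (hsub hs) y)).symm
    _ ≤ Real.exp (M + Real.log (ρ 0 y)) := Real.exp_le_exp.2 h1
    _ = Real.exp M * ρ 0 y := by rw [Real.exp_add, Real.exp_log (hρ.pos 0 (hsub h0) y)]

/-- Supplies a majorant of `∂ₛ ρ̃` that is integrable and independent of `s`, for the dominated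
convergence arguments below. -/
lemma abs_dtLog_mul_le (hρ : IsDensityPath ρ) (ht : t ∈ Icc (0 : ℝ) 1)
    (hM : ∀ s ∈ Icc 0 t, ∀ y, |dtLog ρ s y| ≤ M) {s : ℝ} (hs : s ∈ Icc 0 t)
    (y : EuclideanSpace ℝ (Fin D)) : ‖dtLog ρ s y * ρ s y‖ ≤ M * (Real.exp M * ρ 0 y) := by
  have hpos := hρ.pos s (Icc_subset_Icc_right ht.2 hs) y
  rw [norm_mul, Real.norm_eq_abs, Real.norm_eq_abs, abs_of_pos hpos]
  exact mul_le_mul (hM s hs y) (hρ.density_le ht hM hs y) hpos.le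
    ((abs_nonneg _).trans (hM s hs y))

/-- Differentiation under the integral sign, done on difference quotients so that the endpoints of
`[0,t]` are included; the mean value inequality bounds the quotients by the majorant. -/
lemma hasDerivWithinAt_partitionFn (hρ : IsDensityPath ρ) (ht : t ∈ Icc (0 : ℝ) 1)
    (hM : ∀ s ∈ Icc 0 t, ∀ y, |dtLog ρ s y| ≤ M) {s : ℝ} (hs : s ∈ Icc 0 t) :
    HasDerivWithinAt (partitionFn ρ) (∫ y, dtLog ρ s y * ρ s y) (Icc 0 t) s := by
  have hsub : Icc 0 t ⊆ Icc (0 : ℝ) 1 := Icc_subset_Icc_right ht.2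
  have hder (r : ℝ) (hr : r ∈ Icc 0 t) (y : EuclideanSpace ℝ (Fin D)) :
      HasDerivWithinAt (fun r => ρ r y) (dtLog ρ r y * ρ r y) (Icc 0 t) r := by
    rw [← hρ.densityFDeriv_time (hsub hr)]
    exact (hρ.hasDerivWithinAt_comp (hsub hr) (hasDerivWithinAt_const r _ y)).mono hsub
  rw [hasDerivWithinAt_iff_tendsto_slope]
  have hslope : ∀ᶠ r in 𝓝[Icc 0 t \ {s}] s,
      ∫ y, slope (fun r => ρ r y) s r = slope (partitionFn ρ) s r := by
    filter_upwards [self_mem_nhdsWithin] with r hr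
    simp only [slope_def_field, partitionFn]
    rw [integral_div, integral_sub (hρ.integrable r (hsub hr.1)) (hρ.integrable s (hsub hs))]
  refine Tendsto.congr' hslope ?_
  refine tendsto_integral_filter_of_dominated_convergence (fun y => M * (Real.exp M * ρ 0 y))
    ?_ ?_ (((hρ.integrable 0 (by simp)).const_mul _).const_mul _) ?_
  · filter_upwards [self_mem_nhdsWithin] with r hr
    simp only [slope_def_field]
    exact (((hρ.continuous (hsub hr.1)).sub (hρ.continuous (hsub hs))).div_const _
      ).aestronglyMeasurable
  · filter_upwards [self_mem_nhdsWithin] with r hr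
    refine Eventually.of_forall fun y => ?_
    have key := (convex_Icc 0 t).norm_image_sub_le_of_norm_hasDerivWithin_le
      (fun r hr => hder r hr y) (fun r hr => hρ.abs_dtLog_mul_le ht hM hr y) hs hr.1
    have hne : 0 < ‖r - s‖ := norm_pos_iff.2 (sub_ne_zero.2 hr.2)
    rw [slope_def_field, norm_div, div_le_iff₀ hne]
    exact key
  · refine Eventually.of_forall fun y => ?_
    exact hasDerivWithinAt_iff_tendsto_slope.1 (hder s hs y)

lemma integral_dtLog_targetMeasure (hρ : IsDensityPath ρ) {s : ℝ} (hs : s ∈ Icc (0 : ℝ) 1) :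
    ∫ y, dtLog ρ s y ∂(targetMeasure ρ s) = (∫ y, dtLog ρ s y * ρ s y) / partitionFn ρ s := by
  rw [hρ.integral_targetMeasure hs, ← integral_div]
  congr 1 with y
  ring

lemma continuousOn_mean_dtLog (hρ : IsDensityPath ρ) (ht : t ∈ Icc (0 : ℝ) 1)
    (hM : ∀ s ∈ Icc 0 t, ∀ y, |dtLog ρ s y| ≤ M) :
    ContinuousOn (fun s => ∫ y, dtLog ρ s y ∂(targetMeasure ρ s)) (Icc 0 t) := by
  have hsub : Icc 0 t ⊆ Icc (0 : ℝ) 1 := Icc_subset_Icc_right ht.2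
  refine ContinuousOn.congr (f := fun s => (∫ y, dtLog ρ s y * ρ s y) / partitionFn ρ s) ?_
    fun s hs => hρ.integral_dtLog_targetMeasure (hsub hs)
  refine ContinuousOn.div ?_
    (fun s hs => (hρ.hasDerivWithinAt_partitionFn ht hM hs).continuousWithinAt)
    fun s hs => (hρ.partitionFn_pos (hsub hs)).ne'
  refine continuousOn_of_dominated (bound := fun y => M * (Real.exp M * ρ 0 y))
    (fun s hs => ((hρ.continuous_dtLog (hsub hs)).mul
      (hρ.continuous (hsub hs))).aestronglyMeasurable)
    (fun s hs => Eventually.of_forall fun y => hρ.abs_dtLog_mul_le ht hM hs y)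
    (((hρ.integrable 0 (by simp)).const_mul _).const_mul _)
    (Eventually.of_forall fun y => ?_)
  exact (hρ.continuousOn_dtLog.mul hρ.continuousOn_density).comp
    (continuousOn_id.prodMk continuousOn_const) fun s hs => ⟨hsub hs, mem_univ _⟩

lemma hasDerivWithinAt_log_partitionFn (hρ : IsDensityPath ρ) (ht : t ∈ Icc (0 : ℝ) 1)
    (hM : ∀ s ∈ Icc 0 t, ∀ y, |dtLog ρ s y| ≤ M) {s : ℝ} (hs : s ∈ Icc 0 t) :
    HasDerivWithinAt (fun s => Real.log (partitionFn ρ s))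
      (∫ y, dtLog ρ s y ∂(targetMeasure ρ s)) (Icc 0 t) s := by
  have hs' : s ∈ Icc (0 : ℝ) 1 := Icc_subset_Icc_right ht.2 hs
  rw [hρ.integral_dtLog_targetMeasure hs']
  exact (hρ.hasDerivWithinAt_partitionFn ht hM hs).log (hρ.partitionFn_pos hs').ne'

/-- Thermodynamic integration. -/
lemma integral_mean_dtLog (hρ : IsDensityPath ρ) (ht : t ∈ Icc (0 : ℝ) 1)
    (hM : ∀ s ∈ Icc 0 t, ∀ y, |dtLog ρ s y| ≤ M) :
    ∫ s in (0 : ℝ)..t, ∫ y, dtLog ρ s y ∂(targetMeasure ρ s) =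
      Real.log (partitionFn ρ t) - Real.log (partitionFn ρ 0) := by
  refine intervalIntegral.integral_eq_sub_of_hasDerivAt_of_le ht.1
    (fun s hs => (hρ.hasDerivWithinAt_log_partitionFn ht hM hs).continuousWithinAt)
    (fun s hs => (hρ.hasDerivWithinAt_log_partitionFn ht hM
      (Ioo_subset_Icc_self hs)).hasDerivAt (Icc_mem_nhds hs.1 hs.2)) ?_
  have := hρ.continuousOn_mean_dtLog ht hM
  rw [← uIcc_of_le ht.1] at this
  exact this.intervalIntegrable

end IsDensityPath

end Density

end LFIS

namespace LFIS

/-! ### Weights as a change of density -/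

section Weights

variable {D : ℕ} {ρ : ℝ → EuclideanSpace ℝ (Fin D) → ℝ}
  {v x : ℝ → EuclideanSpace ℝ (Fin D) → EuclideanSpace ℝ (Fin D)} {t M : ℝ}

/-- The score and time terms merge into one logarithmic derivative in the direction `(1, v)`, which
is what the chain rule produces along a trajectory. -/
lemma flowError_eq (hρ : IsDensityPath ρ) {s : ℝ} (hs : s ∈ Icc (0 : ℝ) 1)
    (y : EuclideanSpace ℝ (Fin D)) :
    flowError v ρ s y = divergence (v s) y + densityFDeriv ρ (s, y) (1, v s y) / ρ s y -
      ∫ z, dtLog ρ s z ∂(targetMeasure ρ s) := by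
  have h : ((1 : ℝ), v s y) = (0, v s y) + (1, 0) := by simp
  rw [flowError, sourceTerm, hρ.inner_score hs, hρ.dtLog_eq hs, h, map_add, add_div]
  ring

lemma continuousOn_flowError (hv : IsVelocityField v) (hρ : IsDensityPath ρ)
    (ht : t ∈ Icc (0 : ℝ) 1) (hM : ∀ s ∈ Icc 0 t, ∀ y, |dtLog ρ s y| ≤ M) :
    ContinuousOn (fun p : ℝ × EuclideanSpace ℝ (Fin D) => flowError v ρ p.1 p.2)
      (Icc 0 t ×ˢ univ) := by
  have hsub : Icc 0 t ⊆ Icc (0 : ℝ) 1 := Icc_subset_Icc_right ht.2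
  have hsub' : Icc 0 t ×ˢ (univ : Set (EuclideanSpace ℝ (Fin D))) ⊆ Icc 0 1 ×ˢ univ :=
    prod_mono_left hsub
  refine ContinuousOn.congr ?_ fun p hp => flowError_eq hρ (hsub hp.1) p.2
  refine ((ContinuousOn.add ?_ (ContinuousOn.div ?_ (hρ.continuousOn_density.mono hsub') ?_))).sub
    ((hρ.continuousOn_mean_dtLog ht hM).comp continuousOn_fst fun p hp => hp.1)
  · let tr : (EuclideanSpace ℝ (Fin D) →L[ℝ] EuclideanSpace ℝ (Fin D)) →ₗ[ℝ] ℝ :=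
      (LinearMap.trace ℝ (EuclideanSpace ℝ (Fin D))).comp
        (ContinuousLinearMap.coeLM ℝ)
    have htr : Continuous tr := tr.continuous_of_finiteDimensional
    exact htr.comp_continuousOn (hv.continuousOn_fderiv.mono hsub')
  · exact (hρ.continuousOn_densityFDeriv.mono hsub').clm_apply
      (continuousOn_const.prodMk (hv.continuousOn.mono hsub'))
  · exact fun p hp => (hρ.pos p.1 (hsub hp.1) p.2).ne'

lemma continuousOn_flowError_comp (hv : IsVelocityField v) (hx : IsFlow v x)
    (hρ : IsDensityPath ρ) (ht : t ∈ Icc (0 : ℝ) 1)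
    (hM : ∀ s ∈ Icc 0 t, ∀ y, |dtLog ρ s y| ≤ M) :
    ContinuousOn (fun p : ℝ × EuclideanSpace ℝ (Fin D) => flowError v ρ p.1 (x p.1 p.2))
      (Icc 0 t ×ˢ univ) :=
  (continuousOn_flowError hv hρ ht hM).comp
    (continuousOn_fst.prodMk ((IsFlow.continuousOn hv hx).mono
      (prod_mono_left (Icc_subset_Icc_right ht.2)))) fun _ hp => ⟨hp.1, mem_univ _⟩

/-- With time clamped to `[0, t]`, the unnormalized weight is jointly continuous. -/
lemma continuous_unnormWeight_projIcc (hv : IsVelocityField v) (hx : IsFlow v x)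
    (hρ : IsDensityPath ρ) (ht : t ∈ Icc (0 : ℝ) 1)
    (hM : ∀ s ∈ Icc 0 t, ∀ y, |dtLog ρ s y| ≤ M) :
    Continuous fun p : ℝ × EuclideanSpace ℝ (Fin D) =>
      unnormWeight v ρ x (projIcc 0 t ht.1 p.1) p.2 := by
  let e : EuclideanSpace ℝ (Fin D) → ℝ → ℝ := fun y s =>
    flowError v ρ (projIcc 0 t ht.1 s) (x (projIcc 0 t ht.1 s) y)
  have he : Continuous (Function.uncurry e) :=
    (continuousOn_flowError_comp hv hx hρ ht hM).comp_continuous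
      (f := fun p : EuclideanSpace ℝ (Fin D) × ℝ => ((projIcc 0 t ht.1 p.2 : ℝ), p.1))
      ((continuous_subtype_val.comp (continuous_projIcc.comp continuous_snd)).prodMk continuous_fst)
      fun p => ⟨(projIcc 0 t ht.1 p.2).2, mem_univ _⟩
  have hint : Continuous fun p : ℝ × EuclideanSpace ℝ (Fin D) =>
      ∫ s in (0 : ℝ)..(projIcc 0 t ht.1 p.1 : ℝ), e p.2 s :=
    intervalIntegral.continuous_parametric_intervalIntegral_of_continuous
      (f := fun (p : ℝ × EuclideanSpace ℝ (Fin D)) s => e p.2 s)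
      (he.comp ((continuous_snd.comp continuous_fst).prodMk continuous_snd))
      (continuous_subtype_val.comp (continuous_projIcc.comp continuous_fst))
  refine (Real.continuous_exp.comp hint).congr fun p => ?_
  have hp := (projIcc 0 t ht.1 p.1).2
  simp only [Function.comp, unnormWeight, e]
  congr 1
  refine intervalIntegral.integral_congr fun s hs => ?_
  rw [uIcc_of_le hp.1] at hs
  have : s ∈ Icc 0 t := ⟨hs.1, hs.2.trans hp.2⟩
  simp only [projIcc_of_mem ht.1 this]

/-- The unnormalized weight is the ratio of the target density transported back along the flow to
the initial density. -/
theorem exists_hasFDerivAt_unnormWeight (hv : IsVelocityField v) (hx : IsFlow v x)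
    (hρ : IsDensityPath ρ) (hZ : partitionFn ρ 0 = 1) (ht : t ∈ Icc (0 : ℝ) 1)
    (hM : ∀ s ∈ Icc 0 t, ∀ y, |dtLog ρ s y| ≤ M) {s : ℝ} (hs : s ∈ Icc 0 t)
    (x₀ : EuclideanSpace ℝ (Fin D)) :
    ∃ Φ : EuclideanSpace ℝ (Fin D) →L[ℝ] EuclideanSpace ℝ (Fin D), HasFDerivAt (x s) Φ x₀ ∧
      ρ 0 x₀ * unnormWeight v ρ x s x₀ = |Φ.det| * (ρ s (x s x₀) / partitionFn ρ s) := by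
  have hsub : Icc 0 t ⊆ Icc (0 : ℝ) 1 := Icc_subset_Icc_right ht.2
  obtain ⟨Φ, hΦ0, hΦ⟩ := IsFlow.exists_hasFDerivAt hv hx x₀
  refine ⟨Φ s, (hΦ s (hsub hs)).2, ?_⟩
  let e : ℝ → ℝ := fun r => flowError v ρ r (x r x₀)
  have he : ContinuousOn e (Icc 0 t) :=
    (continuousOn_flowError_comp hv hx hρ ht hM).comp (continuousOn_id.prodMk continuousOn_const)
      fun r hr => ⟨hr, mem_univ _⟩
  have hI (r : ℝ) (hr : r ∈ Icc 0 t) :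
      HasDerivWithinAt (fun r => ∫ q in (0 : ℝ)..r, e q) (e r) (Icc 0 t) r := by
    have hext : Continuous (IccExtend ht.1 ((Icc 0 t).domRestrict e)) :=
      he.domRestrict.Icc_extend'
    have h := (hext.integral_hasStrictDerivAt 0 r).hasDerivAt.hasDerivWithinAt (s := Icc 0 t)
    rw [IccExtend_of_mem _ _ hr] at h
    have hcongr : ∀ q ∈ Icc 0 t, ∫ u in (0 : ℝ)..q, e u =
        ∫ u in (0 : ℝ)..q, IccExtend ht.1 ((Icc 0 t).domRestrict e) u := fun q hq => by
      refine intervalIntegral.integral_congr fun u hu => ?_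
      rw [uIcc_of_le hq.1] at hu
      rw [IccExtend_of_mem _ _ ⟨hu.1, hu.2.trans hq.2⟩]
      rfl
    exact h.congr hcongr (hcongr r hr)
  -- A conserved quantity: the logarithmic derivatives of its factors sum to zero by `flowError_eq`.
  -- Its value at time `0` is `ρ 0 x₀`, since `Z(0) = 1`. The factor `1 / Z` is written as `exp
  -- (-log Z)` to use the known derivative of `log Z`.
  set g : ℝ → ℝ := fun r => (Φ r).det * (ρ r (x r x₀) * Real.exp
    (-Real.log (partitionFn ρ r)) * Real.exp (-∫ q in (0 : ℝ)..r, e q)) with hg_def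
  have hg (r : ℝ) (hr : r ∈ Icc 0 t) : HasDerivWithinAt g 0 (Icc 0 t) r := by
    have hr' := hsub hr
    have h1 := (hasDerivWithinAt_det_of_linear (hΦ r hr').1).mono hsub
    have h2 := (hρ.hasDerivWithinAt_comp hr' (hx.ode x₀ r hr')).mono hsub
    have h3 := (hρ.hasDerivWithinAt_log_partitionFn ht hM hr).neg.exp
    have h4 := (hI r hr).neg.exp
    refine (h1.mul ((h2.mul h3).mul h4)).congr_deriv ?_
    have hpos := (hρ.pos r hr' (x r x₀)).ne'
    have her : e r = _ := flowError_eq hρ hr' (x r x₀)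
    rw [her, divergence]
    simp only [Pi.mul_apply, Pi.neg_apply]
    field_simp
    ring
  have hconst : g s = g 0 := by
    refine constant_of_derivWithin_zero (fun r hr => (hg r hr).differentiableWithinAt) ?_ s hs
    intro r hr
    have hr' := Ico_subset_Icc_self hr
    exact (hg r hr').derivWithin (uniqueDiffOn_Icc (hr.1.trans_lt hr.2) r hr')
  have hg0 : g 0 = ρ 0 x₀ := by
    have : ((1 : EuclideanSpace ℝ (Fin D) →L[ℝ] EuclideanSpace ℝ (Fin D))).det = 1 :=
      LinearMap.det_id
    simp [hg_def, hΦ0, hx.init, hZ, this]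
  have hZs := hρ.partitionFn_pos (hsub hs)
  have hρs := hρ.pos s (hsub hs) (x s x₀)
  have hρ0 := hρ.pos 0 (by simp) x₀
  rw [hg0] at hconst
  simp only [hg_def] at hconst
  rw [Real.exp_neg, Real.exp_neg, Real.exp_log hZs] at hconst
  -- The conserved value is positive, and so are all factors other than the determinant.
  have hdet : 0 < (Φ s).det := by
    rw [← hconst] at hρ0
    exact pos_of_mul_pos_left hρ0 (by positivity)
  rw [abs_of_pos hdet, unnormWeight, ← hconst]
  have := (Real.exp_pos (∫ q in (0 : ℝ)..s, e q)).ne'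
  field_simp
  rfl

/-- Reweighting the law of the flow by the unnormalized weights gives the target distribution. -/
theorem integral_unnormWeight_mul (hv : IsVelocityField v) (hx : IsFlow v x)
    (hρ : IsDensityPath ρ) {μ : Measure (EuclideanSpace ℝ (Fin D))}
    (hμ : μ = volume.withDensity fun y => ENNReal.ofReal (ρ 0 y))
    (hZ : partitionFn ρ 0 = 1) (ht : t ∈ Icc (0 : ℝ) 1)
    (hM : ∀ s ∈ Icc 0 t, ∀ y, |dtLog ρ s y| ≤ M) {s : ℝ} (hs : s ∈ Icc 0 t)
    (hdom : targetMeasure ρ s ≪ flowMeasure x μ s) (f : EuclideanSpace ℝ (Fin D) → ℝ) :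
    ∫ y, unnormWeight v ρ x s y * f (x s y) ∂μ = ∫ y, f y ∂(targetMeasure ρ s) := by
  have hsub : Icc 0 t ⊆ Icc (0 : ℝ) 1 := Icc_subset_Icc_right ht.2
  choose Φ hΦ hw using exists_hasFDerivAt_unnormWeight hv hx hρ hZ ht hM hs
  have hinj : Function.Injective (x s) := IsFlow.injective hv hx (hsub hs)
  have hcont : Continuous (x s) := continuous_iff_continuousAt.2 fun y => (hΦ y).continuousAt
  have hrange : MeasurableSet (range (x s)) := (hcont.measurableEmbedding hinj).measurableSet_range
  -- The law of the flow gives no mass to the complement of its range, so domination passes this to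
  -- the target. As the target density is positive, the complement is then Lebesgue null.
  have hnull : targetMeasure ρ s (range (x s))ᶜ = 0 := by
    refine hdom ?_
    rw [flowMeasure, Measure.map_apply hcont.measurable hrange.compl]
    simp
  have h0 : (0 : ℝ) ∈ Icc (0 : ℝ) 1 := by simp
  have hfull : ∀ᵐ y ∂(volume : Measure (EuclideanSpace ℝ (Fin D))), y ∈ range (x s) := by
    have hmeas : Measurable fun y => ENNReal.ofReal (targetDensity ρ s y) :=
      ((hρ.continuous (hsub hs)).div_const _).measurable.ennreal_ofReal
    rw [targetMeasure, withDensity_apply_eq_zero' hmeas.aemeasurable] at hnull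
    rw [ae_iff]
    convert hnull using 2
    ext y
    have : 0 < targetDensity ρ s y := div_pos (hρ.pos s (hsub hs) y) (hρ.partitionFn_pos (hsub hs))
    simp [this]
  calc ∫ y, unnormWeight v ρ x s y * f (x s y) ∂μ
      = ∫ y, |(Φ y).det| • (ρ s (x s y) / partitionFn ρ s * f (x s y)) := by
        rw [hμ, integral_withDensity_eq_integral_toReal_smul
          (hρ.continuous h0).measurable.ennreal_ofReal
          (Eventually.of_forall fun _ => ENNReal.ofReal_lt_top)]
        refine integral_congr_ae (Eventually.of_forall fun y => ?_)
        simp only [smul_eq_mul]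
        rw [ENNReal.toReal_ofReal (hρ.pos 0 h0 y).le, ← mul_assoc, hw y, mul_assoc]
    _ = ∫ y in range (x s), ρ s y / partitionFn ρ s * f y := by
        rw [← image_univ, integral_image_eq_integral_abs_det_fderiv_smul volume MeasurableSet.univ
          (fun y _ => (hΦ y).hasFDerivWithinAt) hinj.injOn, setIntegral_univ]
    _ = ∫ y, ρ s y / partitionFn ρ s * f y := by
        rw [Measure.restrict_eq_self_of_ae_mem hfull]
    _ = ∫ y, f y ∂(targetMeasure ρ s) := (hρ.integral_targetMeasure (hsub hs) f).symm

end Weights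

end LFIS

namespace LFIS

/-! ### Self-normalized averages -/

section Estimator

/-- The strong law of large numbers for self-normalized importance sampling. -/
theorem tendsto_selfNormalized {S Ω : Type*} [MeasurableSpace S] [MeasurableSpace Ω]
    {P : Measure Ω} {μ : Measure S} {X : ℕ → Ω → S} (hX : ∀ i, Measurable (X i))
    (hlaw : ∀ i, P.map (X i) = μ) (hindep : iIndepFun X P) {w f : S → ℝ} (hw : Measurable w)
    (hf : Measurable f) (hwi : Integrable w μ) (hwfi : Integrable (fun y => w y * f y) μ)
    (hw0 : ∫ y, w y ∂μ ≠ 0) :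
    ∀ᵐ ω ∂P, Tendsto (fun N => ∑ i ∈ Finset.range N,
        w (X i ω) / (∑ j ∈ Finset.range N, w (X j ω)) * f (X i ω)) atTop
      (𝓝 ((∫ y, w y * f y ∂μ) / ∫ y, w y ∂μ)) := by
  have slln {g : S → ℝ} (hg : Measurable g) (hgi : Integrable g μ) :
      ∀ᵐ ω ∂P, Tendsto (fun N : ℕ => (∑ i ∈ Finset.range N, g (X i ω)) / N) atTop
        (𝓝 (∫ y, g y ∂μ)) := by
    have hid (i : ℕ) : IdentDistrib (X i) (X 0) P P :=
      ⟨(hX i).aemeasurable, (hX 0).aemeasurable, by rw [hlaw, hlaw]⟩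
    have h := strong_law_ae_real (μ := P) (fun i => g ∘ X i)
      (by
        rw [← integrable_map_measure (by rw [hlaw]; exact hgi.aestronglyMeasurable)
          (hX 0).aemeasurable, hlaw]
        exact hgi)
      (fun i j hij => (hindep.indepFun hij).comp hg hg) (fun i => (hid i).comp hg)
    have hE : ∫ ω, (g ∘ X 0) ω ∂P = ∫ y, g y ∂μ := by
      rw [← hlaw 0, integral_map (hX 0).aemeasurable (by rw [hlaw]; exact hgi.aestronglyMeasurable)]
      rfl
    rw [hE] at h
    exact h
  filter_upwards [slln hw hwi, slln (hw.mul hf) hwfi] with ω h1 h2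
  -- The estimator is a quotient of two empirical means, in which the factors `1 / N` cancel for `N
  -- > 0`.
  refine (h2.div h1 hw0).congr' ?_
  filter_upwards [eventually_gt_atTop 0] with N hN
  have hN' : (N : ℝ) ≠ 0 := Nat.cast_ne_zero.2 hN.ne'
  simp only [Pi.div_apply, Pi.mul_apply]
  rw [div_div_div_cancel_right₀ hN', Finset.sum_div]
  exact Finset.sum_congr rfl fun i _ => by ring

variable {D : ℕ} {ρ : ℝ → EuclideanSpace ℝ (Fin D) → ℝ}
  {v x : ℝ → EuclideanSpace ℝ (Fin D) → EuclideanSpace ℝ (Fin D)} {t M : ℝ}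

lemma abs_weightedAverage_le (z : ℕ → EuclideanSpace ℝ (Fin D)) (N : ℕ) {s : ℝ}
    (hM : ∀ y, |dtLog ρ s y| ≤ M) : |weightedAverage v ρ x z N s| ≤ M := by
  have hM0 : 0 ≤ M := (abs_nonneg _).trans (hM 0)
  have hw (i : ℕ) : 0 ≤ unnormWeight v ρ x s (z i) := (Real.exp_pos _).le
  have hS : 0 ≤ ∑ j ∈ Finset.range N, unnormWeight v ρ x s (z j) :=
    Finset.sum_nonneg fun i _ => hw i
  calc |weightedAverage v ρ x z N s|
      ≤ ∑ i ∈ Finset.range N, |normWeight v ρ x z N i s * dtLog ρ s (x s (z i))| :=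
        Finset.abs_sum_le_sum_abs _ _
    _ ≤ ∑ i ∈ Finset.range N, normWeight v ρ x z N i s * M := by
        refine Finset.sum_le_sum fun i _ => ?_
        have hn : 0 ≤ normWeight v ρ x z N i s := div_nonneg (hw i) hS
        rw [abs_mul, abs_of_nonneg hn]
        exact mul_le_mul_of_nonneg_left (hM _) hn
    _ = (∑ i ∈ Finset.range N, unnormWeight v ρ x s (z i)) /
          (∑ j ∈ Finset.range N, unnormWeight v ρ x s (z j)) * M := by
        rw [← Finset.sum_mul, Finset.sum_div]; rfl
    -- Only an inequality: for `N = 0` the quotient is `0 / 0 = 0`.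
    _ ≤ 1 * M := by gcongr; exact div_self_le_one _
    _ = M := one_mul M

lemma continuousOn_dtLog_comp (hv : IsVelocityField v) (hx : IsFlow v x) (hρ : IsDensityPath ρ) :
    ContinuousOn (fun p : ℝ × EuclideanSpace ℝ (Fin D) => dtLog ρ p.1 (x p.1 p.2))
      (Icc 0 1 ×ˢ univ) :=
  hρ.continuousOn_dtLog.comp (continuousOn_fst.prodMk (IsFlow.continuousOn hv hx))
    fun _ hp => ⟨hp.1, mem_univ _⟩

lemma continuous_dtLog_comp_projIcc (hv : IsVelocityField v) (hx : IsFlow v x)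
    (hρ : IsDensityPath ρ) (ht : t ∈ Icc (0 : ℝ) 1) :
    Continuous fun p : ℝ × EuclideanSpace ℝ (Fin D) =>
      dtLog ρ (projIcc 0 t ht.1 p.1) (x (projIcc 0 t ht.1 p.1) p.2) :=
  (continuousOn_dtLog_comp hv hx hρ).comp_continuous
    (f := fun p : ℝ × EuclideanSpace ℝ (Fin D) => ((projIcc 0 t ht.1 p.1 : ℝ), p.2))
    ((continuous_subtype_val.comp (continuous_projIcc.comp continuous_fst)).prodMk continuous_snd)
    fun p => ⟨Icc_subset_Icc_right ht.2 (projIcc 0 t ht.1 p.1).2, mem_univ _⟩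

/-- With time clamped to `[0, t]`, the weighted average is jointly measurable. -/
lemma measurable_weightedAverage_projIcc (hv : IsVelocityField v) (hx : IsFlow v x)
    (hρ : IsDensityPath ρ) (ht : t ∈ Icc (0 : ℝ) 1)
    (hM : ∀ s ∈ Icc 0 t, ∀ y, |dtLog ρ s y| ≤ M) {Ω : Type*} [MeasurableSpace Ω]
    {X : ℕ → Ω → EuclideanSpace ℝ (Fin D)} (hX : ∀ i, Measurable (X i)) (N : ℕ) :
    Measurable fun p : Ω × ℝ =>
      weightedAverage v ρ x (fun i => X i p.1) N (projIcc 0 t ht.1 p.2) := by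
  have hpair (i : ℕ) : Measurable fun p : Ω × ℝ => (p.2, X i p.1) :=
    measurable_snd.prodMk ((hX i).comp measurable_fst)
  have hw := (continuous_unnormWeight_projIcc hv hx hρ ht hM).measurable
  have ha := (continuous_dtLog_comp_projIcc hv hx hρ ht).measurable
  have hw' (i : ℕ) := hw.comp (hpair i)
  have ha' (i : ℕ) := ha.comp (hpair i)
  simp only [Function.comp_def] at hw' ha'
  unfold weightedAverage normWeight
  fun_prop

end Estimator

end LFIS

/-! ### Convergence of the estimator -/

theorem theorem2 {D : ℕ}
    (v : ℝ → EuclideanSpace ℝ (Fin D) → EuclideanSpace ℝ (Fin D))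
    (hv : LFIS.IsVelocityField v)
    (x : ℝ → EuclideanSpace ℝ (Fin D) → EuclideanSpace ℝ (Fin D))
    (hx : LFIS.IsFlow v x)
    (ρ : ℝ → EuclideanSpace ℝ (Fin D) → ℝ)
    (hρ : LFIS.IsDensityPath ρ)
    (μ : Measure (EuclideanSpace ℝ (Fin D))) [IsProbabilityMeasure μ]
    (hμ : μ = volume.withDensity (fun y => ENNReal.ofReal (ρ 0 y)))
    {Ω : Type*} [MeasurableSpace Ω] (P : Measure Ω) [IsProbabilityMeasure P]
    (X : ℕ → Ω → EuclideanSpace ℝ (Fin D))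
    (hX_meas : ∀ i, Measurable (X i))
    (hX_law : ∀ i, P.map (X i) = μ)
    (hX_indep : iIndepFun X P)
    (t : ℝ) (ht : t ∈ Icc (0 : ℝ) 1)
    (h_int : ∀ s ∈ Icc 0 t, Integrable (LFIS.dtLog ρ s) (LFIS.targetMeasure ρ s))
    (h_dom : ∀ s ∈ Icc 0 t, LFIS.targetMeasure ρ s ≪ LFIS.flowMeasure x μ s)
    (h_weight : ∃ M₁ : ℝ, ∀ s ∈ Icc 0 t, ∀ x₀, |LFIS.unnormWeight v ρ x s x₀| < M₁)
    (h_dtLog : ∃ M₂ : ℝ, ∀ s ∈ Icc 0 t, ∀ y, |LFIS.dtLog ρ s y| < M₂) :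
    (∀ N ω, IntervalIntegrable
      (LFIS.weightedAverage v ρ x (fun i => X i ω) N) volume 0 t) ∧
    (∀ᵐ ω ∂P, Tendsto
      (fun N => ∫ s in (0 : ℝ)..t, LFIS.weightedAverage v ρ x (fun i => X i ω) N s)
      atTop (𝓝 (Real.log (LFIS.partitionFn ρ t)))) ∧
    (∀ N, Integrable
      (fun ω => ∫ s in (0 : ℝ)..t, LFIS.weightedAverage v ρ x (fun i => X i ω) N s) P) ∧
    Tendsto
      (fun N => ∫ ω, (∫ s in (0 : ℝ)..t, LFIS.weightedAverage v ρ x (fun i => X i ω) N s) ∂P)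
      atTop (𝓝 (Real.log (LFIS.partitionFn ρ t))) := by
  obtain ⟨M₁, hM₁⟩ := h_weight
  obtain ⟨M, hM'⟩ := h_dtLog
  have hM : ∀ s ∈ Icc 0 t, ∀ y, |LFIS.dtLog ρ s y| ≤ M := fun s hs y => (hM' s hs y).le
  have hsub : Icc 0 t ⊆ Icc (0 : ℝ) 1 := Icc_subset_Icc_right ht.2
  have h0 : (0 : ℝ) ∈ Icc (0 : ℝ) 1 := by simp
  have hZ : LFIS.partitionFn ρ 0 = 1 := by
    have h1 : μ univ = 1 := measure_univ
    rw [hμ, withDensity_apply _ MeasurableSet.univ, setLIntegral_univ] at h1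
    rw [LFIS.partitionFn, integral_eq_lintegral_of_nonneg_ae
      (Eventually.of_forall fun y => (hρ.pos 0 h0 y).le) (hρ.continuous h0).aestronglyMeasurable,
      h1, ENNReal.toReal_one]
  -- Clamping time to `[0, t]` makes the average jointly measurable and bounded by `M` on all of `Ω
  -- × ℝ`, without changing the integrals.
  set W : ℕ → Ω → ℝ → ℝ := fun N ω s =>
    LFIS.weightedAverage v ρ x (fun i => X i ω) N (projIcc 0 t ht.1 s) with hW_def
  have hWmeas (N : ℕ) : Measurable fun p : Ω × ℝ => W N p.1 p.2 :=
    LFIS.measurable_weightedAverage_projIcc hv hx hρ ht hM hX_meas N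
  have hWbound (N : ℕ) (ω : Ω) (s : ℝ) : ‖W N ω s‖ ≤ M :=
    LFIS.abs_weightedAverage_le _ N (hM _ (projIcc 0 t ht.1 s).2)
  have hWeq (N : ℕ) (ω : Ω) {s : ℝ} (hs : s ∈ Icc 0 t) :
      W N ω s = LFIS.weightedAverage v ρ x (fun i => X i ω) N s := by
    simp only [hW_def, projIcc_of_mem ht.1 hs]
  have hioc : uIoc 0 t ⊆ Icc 0 t := by
    rw [uIoc_of_le ht.1]; exact Ioc_subset_Icc_self
  have hint (N : ℕ) (ω : Ω) :
      ∫ s in (0 : ℝ)..t, LFIS.weightedAverage v ρ x (fun i => X i ω) N s =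
        ∫ s in (0 : ℝ)..t, W N ω s := by
    refine intervalIntegral.integral_congr fun s hs => ?_
    rw [uIcc_of_le ht.1] at hs
    exact (hWeq N ω hs).symm
  have hWint (N : ℕ) (ω : Ω) : IntervalIntegrable (W N ω) volume 0 t := by
    refine (intervalIntegrable_const (c := M)).mono_fun
      ((hWmeas N).comp measurable_prodMk_left).aestronglyMeasurable
      (Eventually.of_forall fun s => (hWbound N ω s).trans (le_abs_self M))
  have hpoint (s : ℝ) (hs : s ∈ Icc 0 t) : ∀ᵐ ω ∂P, Tendsto (fun N => W N ω s) atTop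
      (𝓝 (∫ y, LFIS.dtLog ρ s y ∂(LFIS.targetMeasure ρ s))) := by
    have hwc : Continuous (LFIS.unnormWeight v ρ x s) := by
      have := (LFIS.continuous_unnormWeight_projIcc hv hx hρ ht hM).comp
        (Continuous.prodMk_right s)
      simpa only [Function.comp_def, projIcc_of_mem ht.1 hs] using this
    have hxc : Continuous (x s) := (LFIS.IsFlow.continuousOn hv hx).comp_continuous
      (Continuous.prodMk_right s) fun _ => ⟨hsub hs, mem_univ _⟩
    have hfc : Continuous fun y => LFIS.dtLog ρ s (x s y) :=
      (hρ.continuous_dtLog (hsub hs)).comp hxc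
    have hwi : Integrable (LFIS.unnormWeight v ρ x s) μ :=
      Integrable.of_bound hwc.aestronglyMeasurable M₁
        (Eventually.of_forall fun y => (hM₁ s hs y).le)
    have hwfi : Integrable (fun y => LFIS.unnormWeight v ρ x s y * LFIS.dtLog ρ s (x s y)) μ :=
      hwi.mul_bdd (c := M) hfc.aestronglyMeasurable (Eventually.of_forall fun y => hM s hs _)
    -- Reweighting with `f = 1`: the weights have mean one, so the ratio in the limit is just the
    -- target mean.
    have hw1 : ∫ y, LFIS.unnormWeight v ρ x s y ∂μ = 1 := by
      have := LFIS.integral_unnormWeight_mul hv hx hρ hμ hZ ht hM hs (h_dom s hs) fun _ => 1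
      simpa only [mul_one, hρ.integral_one_targetMeasure (hsub hs)] using this
    have key := LFIS.tendsto_selfNormalized hX_meas hX_law hX_indep hwc.measurable hfc.measurable
      hwi hwfi (by rw [hw1]; exact one_ne_zero)
    rw [hw1, div_one, LFIS.integral_unnormWeight_mul hv hx hρ hμ hZ ht hM hs (h_dom s hs)] at key
    filter_upwards [key] with ω hω
    exact hω.congr fun N => (hWeq N ω hs).symm
  -- The exceptional set of `ω` depends on `s`. Joint measurability of the convergence set allows
  -- the two almost-everywhere quantifiers to be exchanged.
  have hae : ∀ᵐ ω ∂P, ∀ᵐ s ∂(volume.restrict (uIoc 0 t)), Tendsto (fun N => W N ω s) atTop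
      (𝓝 (∫ y, LFIS.dtLog ρ (projIcc 0 t ht.1 s) y
        ∂(LFIS.targetMeasure ρ (projIcc 0 t ht.1 s)))) := by
    rw [Measure.ae_ae_comm]
    · refine (ae_restrict_iff' measurableSet_uIoc).2 (Eventually.of_forall fun s hs => ?_)
      rw [projIcc_of_mem ht.1 (hioc hs)]
      exact hpoint s (hioc hs)
    · have hmean : Measurable fun p : Ω × ℝ => ∫ y, LFIS.dtLog ρ (projIcc 0 t ht.1 p.2) y
          ∂(LFIS.targetMeasure ρ (projIcc 0 t ht.1 p.2)) := by
        have := (hρ.continuousOn_mean_dtLog ht hM).comp_continuous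
          (continuous_subtype_val.comp (continuous_projIcc (h := ht.1)))
          fun s => (projIcc 0 t ht.1 s).2
        exact this.measurable.comp measurable_snd
      exact measurableSet_tendsto_fun hWmeas hmean
  have hlim : ∀ᵐ ω ∂P, Tendsto
      (fun N => ∫ s in (0 : ℝ)..t, LFIS.weightedAverage v ρ x (fun i => X i ω) N s)
      atTop (𝓝 (Real.log (LFIS.partitionFn ρ t))) := by
    have hlog := hρ.integral_mean_dtLog ht hM
    rw [hZ, Real.log_one, sub_zero] at hlog
    filter_upwards [hae] with ω hω
    rw [← hlog]
    simp only [hint]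
    refine intervalIntegral.tendsto_integral_filter_of_dominated_convergence (fun _ => M)
      (Eventually.of_forall fun N => ((hWmeas N).comp measurable_prodMk_left).aestronglyMeasurable)
      (Eventually.of_forall fun N => Eventually.of_forall fun s _ => hWbound N ω s)
      intervalIntegrable_const ?_
    filter_upwards [(ae_restrict_iff' measurableSet_uIoc).1 hω] with s hs hst
    have := hs hst
    rwa [projIcc_of_mem ht.1 (hioc hst)] at this
  have hmeas (N : ℕ) : AEStronglyMeasurable
      (fun ω => ∫ s in (0 : ℝ)..t, LFIS.weightedAverage v ρ x (fun i => X i ω) N s) P := by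
    simp only [hint, intervalIntegral.integral_of_le ht.1]
    exact ((hWmeas N).stronglyMeasurable.integral_prod_right
      (ν := volume.restrict (Ioc 0 t))).aestronglyMeasurable
  have hbound (N : ℕ) (ω : Ω) :
      ‖∫ s in (0 : ℝ)..t, LFIS.weightedAverage v ρ x (fun i => X i ω) N s‖ ≤ M * |t - 0| := by
    rw [hint]
    exact intervalIntegral.norm_integral_le_of_norm_le_const fun s _ => hWbound N ω s
  refine ⟨fun N ω => ?_, hlim, fun N => ?_, ?_⟩
  · refine (hWint N ω).congr fun s hs => hWeq N ω (hioc hs)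
  · exact Integrable.of_bound (hmeas N) _ (Eventually.of_forall (hbound N))
  · have := tendsto_integral_of_dominated_convergence (μ := P) (fun _ => M * |t - 0|) hmeas
      (integrable_const _) (fun N => Eventually.of_forall (hbound N)) hlim
    simpa using this
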